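/- **Setting.** Let $\sigma(t)=1/(1+e^{-t})$. For $\beta\in\mathbb{R}^d$ let $Q_\beta$ be the law on $\mathbb{R}^d\times\{0,1\}$ of $(X,Y)$ with $X\sim N(0,I_d)$ and $\mathbb{P}(Y=1\mid X=x)=\eta_\beta(x):=\sigma(\beta^Tx)$. For a classifier $f:\mathbb{R}^d\to\{0,1\}$ put $R_\beta(f)=Q_\beta(Y\ne f(X))$, and let $\mathcal{E}_{Q_\beta}(f)=R_\beta(f)-R_\beta(f^*_\beta)$ be its excess risk, where $f^*_\beta(x)=\mathbf{1}\{\eta_\beta(x)\ge 1/2\}$ is the Bayes classifier. For $\Delta\in[0,\pi/2]$ let $$\Pi^{LR}(s,\Delta)=\{(Q_{\beta_Q},Q_{\beta_P}) : \beta_Q,\beta_P\in\mathbb{R}^d\setminus\{0\},\ \|\beta_Q\|_0\le s,\ \angle(\beta_Q,\beta_P)\le\Delta\},$$ where $\|\cdot\|_0$ is the number of nonzero entries and $\angle\in[0,\pi]$ is the usual angle. For $(Q,P)\in\Pi^{LR}(s,\Delta)$ one observes $n_Q$ i.i.d. target observations from $Q$ and, independently, $n_P$ i.i.d. source observations from $P$.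 An empirical classifier $\hat f$ is a measurable function of these data and of a new covariate, with values in $\{0,1\}$, and $\mathbb{E}$ denotes expectation over the data. **Theorem.** For all constants $C,K>0$ there is a constant $c>0$, depending only on $C$ and $K$, such that for all integers $1\le s\le d$, $n_Q\ge1$, $n_P\ge1$ and all $\Delta\in[0,\pi/2]$ with $$\frac{s\log d}{n_Q\vee n_P}\le C\qquad\text{and}\qquad \log d\le K\log\frac{e\,d}{s},$$ we have $$\inf_{\hat f}\ \sup_{(Q,P)\in\Pi^{LR}(s,\Delta)}\mathbb{E}\,\mathcal{E}_Q(\hat f)\ \ge\ c\left[\left(\frac{s\log d}{n_P}+\Delta^2\right)\wedge\frac{s\log d}{n_Q}\right].$$ -/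

import Mathlib

open MeasureTheory ProbabilityTheory
open scoped ENNReal

noncomputable section

namespace LogisticTransfer

/-- One labelled observation `(x, y)`, with `x ∈ ℝ^d` and `y ∈ {0, 1}`
(`true` is the label `1`, `false` the label `0`). -/
abbrev Obs (d : ℕ) : Type := EuclideanSpace ℝ (Fin d) × Bool

/-- The logistic regression function `η(x) = σ(βᵀ x)`. -/
def regFun {d : ℕ} (β x : EuclideanSpace ℝ (Fin d)) : ℝ :=
  Real.sigmoid (inner ℝ β x)

/-- Conditional probability of the label `y` given the covariate `x`. -/
def labelProb {d : ℕ} (β : EuclideanSpace ℝ (Fin d)) (z : Obs d) : ℝ :=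
  if z.2 = true then regFun β z.1 else 1 - regFun β z.1

/-- The logistic model `Q_β` on `ℝ^d × {0, 1}`: `X ∼ N(0, I_d)` and `P(Y = 1 | X = x) = σ(βᵀ x)`,
given by its density with respect to `N(0, I_d) ⊗ counting measure`. -/
def model {d : ℕ} (β : EuclideanSpace ℝ (Fin d)) : Measure (Obs d) :=
  ((stdGaussian (EuclideanSpace ℝ (Fin d))).prod Measure.count).withDensity
    fun z => ENNReal.ofReal (labelProb β z)

/-- The misclassification rate `R(f) = Q(Y ≠ f(X))`. -/
def risk {d : ℕ} (Q : Measure (Obs d)) (f : EuclideanSpace ℝ (Fin d) → Bool) : ℝ :=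
  Q.real {z | z.2 ≠ f z.1}

/-- The Bayes classifier `f*(x) = 1{η(x) ≥ 1/2}` of a regression function `η`. -/
def bayesClassifier {d : ℕ} (η : EuclideanSpace ℝ (Fin d) → ℝ) :
    EuclideanSpace ℝ (Fin d) → Bool :=
  fun x => decide (1 / 2 ≤ η x)

/-- The excess risk `R(f) - R(f*)` under the target distribution `Q_β`. -/
def excessRisk {d : ℕ} (β : EuclideanSpace ℝ (Fin d)) (f : EuclideanSpace ℝ (Fin d) → Bool) : ℝ :=
  risk (model β) f - risk (model β) (bayesClassifier (regFun β))

/-- The parameter space `Θ(s, Δ)` of pairs `(β_Q, β_P)`: `β_Q` has at most `s` nonzero entries and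
the angle between the (nonzero) vectors `β_Q` and `β_P` is at most `Δ`. -/
def paramSpace (d s : ℕ) (Δ : ℝ) :
    Set (EuclideanSpace ℝ (Fin d) × EuclideanSpace ℝ (Fin d)) :=
  {p | p.1 ≠ 0 ∧ p.2 ≠ 0 ∧ (Finset.univ.filter fun i => p.1 i ≠ 0).card ≤ s ∧
    InnerProductGeometry.angle p.1 p.2 ≤ Δ}

/-- The two independent samples: `nQ` target observations and `nP` source observations. -/
abbrev Data (d nQ nP : ℕ) : Type := (Fin nQ → Obs d) × (Fin nP → Obs d)

/-- The law of the data: `nQ` i.i.d. draws from `Q_β` and, independently, `nP` i.i.d. draws from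
`P_w`. -/
def dataLaw {d : ℕ} (nQ nP : ℕ) (β w : EuclideanSpace ℝ (Fin d)) : Measure (Data d nQ nP) :=
  (Measure.pi fun _ : Fin nQ => model β).prod (Measure.pi fun _ : Fin nP => model w)

/-- The empirical classifiers: (jointly measurable) maps from the data and a new covariate to a
label. -/
def empiricalClassifiers (d nQ nP : ℕ) :
    Set (Data d nQ nP → EuclideanSpace ℝ (Fin d) → Bool) :=
  {f | Measurable fun q : Data d nQ nP × EuclideanSpace ℝ (Fin d) => f q.1 q.2}

/-- The expected excess risk `𝔼 ℰ_Q(f̂)` of an empirical classifier; the excess risk is nonnegative,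
see `excessRisk_nonneg`. -/
def expectedExcessRisk {d nQ nP : ℕ} (f : Data d nQ nP → EuclideanSpace ℝ (Fin d) → Bool)
    (β w : EuclideanSpace ℝ (Fin d)) : ℝ≥0∞ :=
  ∫⁻ D, ENNReal.ofReal (excessRisk β (f D)) ∂(dataLaw nQ nP β w)

/-- The minimax expected excess risk over the logistic family:
the infimum over empirical classifiers of the supremum over `(β_Q, β_P) ∈ Θ(s, Δ)`. -/
def minimaxExcessRisk (d s nQ nP : ℕ) (Δ : ℝ) : ℝ≥0∞ :=
  ⨅ f ∈ empiricalClassifiers d nQ nP, ⨆ p ∈ paramSpace d s Δ, expectedExcessRisk f p.1 p.2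

/-! Basic facts confirming that `model β` is the intended distribution. -/

theorem measurable_regFun {d : ℕ} (β : EuclideanSpace ℝ (Fin d)) : Measurable (regFun β) := by
  unfold regFun
  exact continuous_sigmoid.measurable.comp (by fun_prop)

theorem regFun_nonneg {d : ℕ} (β x : EuclideanSpace ℝ (Fin d)) : 0 ≤ regFun β x :=
  Real.sigmoid_nonneg _

theorem regFun_le_one {d : ℕ} (β x : EuclideanSpace ℝ (Fin d)) : regFun β x ≤ 1 :=
  Real.sigmoid_le_one _

theorem measurable_labelProb {d : ℕ} (β : EuclideanSpace ℝ (Fin d)) :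
    Measurable (labelProb β) := by
  unfold labelProb
  refine Measurable.ite (measurable_snd (measurableSet_singleton true))
    ((measurable_regFun β).comp measurable_fst)
    (measurable_const.sub ((measurable_regFun β).comp measurable_fst))

theorem model_apply {d : ℕ} (β : EuclideanSpace ℝ (Fin d)) {S : Set (Obs d)}
    (hS : MeasurableSet S) :
    model β S = ∫⁻ x, (S.indicator (fun z => ENNReal.ofReal (labelProb β z)) (x, true) +
      S.indicator (fun z => ENNReal.ofReal (labelProb β z)) (x, false))
        ∂(stdGaussian (EuclideanSpace ℝ (Fin d))) := by
  have hm : Measurable fun z => ENNReal.ofReal (labelProb β z) :=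
    (measurable_labelProb β).ennreal_ofReal
  rw [model, withDensity_apply _ hS, ← lintegral_indicator hS,
    lintegral_prod _ (hm.indicator hS).aemeasurable]
  simp [lintegral_count, add_comm]

/-- The covariates of `Q_β` are `N(0, I_d)`. -/
theorem model_fst {d : ℕ} (β : EuclideanSpace ℝ (Fin d)) :
    (model β).fst = stdGaussian (EuclideanSpace ℝ (Fin d)) := by
  ext A hA
  rw [Measure.fst_apply hA, model_apply β (measurable_fst hA), ← lintegral_indicator_one hA]
  refine lintegral_congr fun x => ?_
  by_cases hx : x ∈ A
  · simp only [Set.indicator, Set.mem_preimage, hx, if_true, labelProb, Pi.one_apply]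
    rw [← ENNReal.ofReal_add (regFun_nonneg β x)
      (by simpa using sub_nonneg.2 (regFun_le_one β x))]
    simp
  · simp [Set.indicator, hx]

instance {d : ℕ} (β : EuclideanSpace ℝ (Fin d)) : IsProbabilityMeasure (model β) := by
  refine ⟨?_⟩
  rw [← Measure.fst_univ, model_fst, measure_univ]

/-- `η(x) = σ(βᵀ x)` is the regression function `Q_β(Y = 1 | X = x)`. -/
theorem model_regFun {d : ℕ} (β : EuclideanSpace ℝ (Fin d)) {A : Set (EuclideanSpace ℝ (Fin d))}
    (hA : MeasurableSet A) :
    model β (A ×ˢ {true}) = ∫⁻ x in A, ENNReal.ofReal (regFun β x) ∂(model β).fst := by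
  rw [model_apply β (hA.prod (measurableSet_singleton true)), model_fst, ← lintegral_indicator hA]
  refine lintegral_congr fun x => ?_
  by_cases hx : x ∈ A <;> simp [Set.indicator, hx, labelProb]

theorem excessRisk_nonneg {d : ℕ} (β : EuclideanSpace ℝ (Fin d))
    {f : EuclideanSpace ℝ (Fin d) → Bool} (hf : Measurable f) : 0 ≤ excessRisk β f := by
  have hb : Measurable (bayesClassifier (regFun β)) := by
    refine measurable_to_bool ?_
    have : bayesClassifier (regFun β) ⁻¹' {true} = {x | 1 / 2 ≤ regFun β x} := by
      ext x; simp [bayesClassifier]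
    rw [this]
    exact measurableSet_le measurable_const (measurable_regFun β)
  have hS : ∀ g : EuclideanSpace ℝ (Fin d) → Bool, Measurable g →
      MeasurableSet {z : Obs d | z.2 ≠ g z.1} := fun g hg =>
    (measurableSet_eq_fun measurable_snd (hg.comp measurable_fst)).compl
  refine sub_nonneg.2 (ENNReal.toReal_mono (measure_ne_top _ _) ?_)
  rw [model_apply β (hS _ hb), model_apply β (hS _ hf)]
  refine lintegral_mono fun x => ?_
  by_cases h : 1 / 2 ≤ regFun β x <;> cases hfx : f x <;>
    simp only [Set.indicator, Set.mem_ofPred_eq, bayesClassifier, hfx, h, labelProb] <;>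
    simp <;> refine ENNReal.ofReal_le_ofReal ?_ <;> linarith

end LogisticTransfer

end

/-! Minimax lower bound for transfer learning in sparse logistic regression.

The source vector is a small multiple of the target vector: the angle between them is zero, and the
`nP` source observations together carry no more information than a single target observation.
The target vectors all have length of order `√(s log d / nQ)` (at most one), where the excess risk is
proportional to the length, which gives a bound stronger than the stated rate. -/

open MeasureTheory ProbabilityTheory
open scoped ENNReal

noncomputable section

namespace LogisticTransfer

/-! The argument is a many-hypotheses bound with reference law `dataLaw nQ nP 0 0`, under which
labels are fair coins. Fix vectors `β ω` of common length `κ ≤ 1`.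

Separation: if two of them have inner product at most `κ ^ 2 / 2`, then with constant probability a
Gaussian covariate has inner products with them of opposite signs and size at least `κ / 4`. Any
label is then wrong for one of the two and costs order `κ`, so no classifier has excess risk below
`δ = separationConst * κ / 2` for both (`separation_excessRisk`). Hence the events that the excess
risk under `β ω` is below `δ` overlap at most `N` times, where `N` bounds the number of vectors
close to a given one, and their reference probabilities sum to at most `N`.

Information: the likelihood ratio has second moment at most `exp (nQ * ‖β‖ ^ 2 + nP * ‖w‖ ^ 2)`.
With `w = β / √nP` this is at most `exp (2 * nQ * κ ^ 2)`. If `N` times this is at most 3/4 of the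
number of hypotheses, some hypothesis gives its event probability at most 7/8, and the risk is at
least of order `κ` (`le_minimaxExcessRisk`).

Packing: with `m = d / s ≥ 16`, choosing one coordinate in each of `s` blocks gives `m ^ s` vectors,
at most `(2 √m) ^ s` of them close to a given one, which permits `nQ * κ ^ 2` of order `s log m`. If
`m < 16`, the condition on `log d` bounds `s log d`, and two opposite vectors suffice. Since the
claimed rate is bounded, a bound by a square root capped at one dominates it. -/

/-! ### Product densities and change of measure -/

theorem lintegral_pi_prod {ι : Type*} [Fintype ι] {α : ι → Type*} [∀ i, MeasurableSpace (α i)]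
    (μ : ∀ i, Measure (α i)) [∀ i, IsProbabilityMeasure (μ i)] {f : ∀ i, α i → ℝ≥0∞}
    (hf : ∀ i, Measurable (f i)) :
    ∫⁻ x, ∏ i, f i (x i) ∂(Measure.pi μ) = ∏ i, ∫⁻ a, f i a ∂(μ i) := by
  rw [lintegral_prod_eq_prod_lintegral_of_indepFun Finset.univ (fun i (x : ∀ i, α i) => f i (x i))
    (iIndepFun_pi fun i => (hf i).aemeasurable) (fun i => (hf i).comp (measurable_pi_apply i))]
  refine Finset.prod_congr rfl fun i _ => ?_
  exact (measurePreserving_eval μ i).lintegral_comp (hf i)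

theorem pi_withDensity {ι : Type*} [Fintype ι] {α : ι → Type*} [∀ i, MeasurableSpace (α i)]
    (μ : ∀ i, Measure (α i)) [∀ i, IsProbabilityMeasure (μ i)] {f : ∀ i, α i → ℝ≥0∞}
    (hf : ∀ i, Measurable (f i)) [∀ i, SigmaFinite ((μ i).withDensity (f i))] :
    Measure.pi (fun i => (μ i).withDensity (f i)) =
      (Measure.pi μ).withDensity fun x => ∏ i, f i (x i) := by
  refine Measure.pi_eq fun s hs => ?_
  rw [withDensity_apply _ (MeasurableSet.univ_pi hs),
    ← lintegral_indicator (MeasurableSet.univ_pi hs)]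
  have : (Set.univ.pi s).indicator (fun x => ∏ i, f i (x i)) =
      fun x => ∏ i, (s i).indicator (f i) (x i) := by
    ext x
    by_cases hx : x ∈ Set.univ.pi s
    · rw [Set.indicator_of_mem hx]
      exact Finset.prod_congr rfl fun i _ => (Set.indicator_of_mem (hx i trivial) _).symm
    · rw [Set.indicator_of_notMem hx]
      obtain ⟨i, hi⟩ : ∃ i, x i ∉ s i := by simpa using hx
      exact (Finset.prod_eq_zero (Finset.mem_univ i) (Set.indicator_of_notMem hi _)).symm
  rw [this, lintegral_pi_prod μ fun i => (hf i).indicator (hs i)]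
  refine Finset.prod_congr rfl fun i _ => ?_
  rw [lintegral_indicator (hs i), withDensity_apply _ (hs i)]

/-- If the density `L` of `P` with respect to `P₀` has second moment at most `Λ`, then
`2 P(A) ≤ t P₀(A) + Λ / t`. -/
theorem two_mul_withDensity_le {α : Type*} [MeasurableSpace α] (P₀ : Measure α)
    {L : α → ℝ≥0∞} (hL : Measurable L) {A : Set α} (hA : MeasurableSet A)
    {t : ℝ} (ht : 0 < t) :
    2 * P₀.withDensity L A ≤
      ENNReal.ofReal t * P₀ A + ENNReal.ofReal t⁻¹ * ∫⁻ a, L a ^ 2 ∂P₀ := by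
  -- AM-GM applied pointwise to the density; the difference of the sides is `(t - x) ^ 2 / t`.
  have key : ∀ x : ℝ≥0∞, 2 * x ≤ ENNReal.ofReal t + ENNReal.ofReal t⁻¹ * x ^ 2 := by
    intro x
    have ht' : ENNReal.ofReal t⁻¹ ≠ 0 := by simpa using ht
    rcases eq_or_ne x ⊤ with rfl | hx
    · simp [ENNReal.mul_top ht']
    · lift x to NNReal using hx
      rw [← ENNReal.ofReal_coe_nnreal, ← ENNReal.ofReal_pow x.coe_nonneg,
        ← ENNReal.ofReal_mul (by positivity), ← ENNReal.ofReal_add ht.le (by positivity),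
        show (2 : ℝ≥0∞) = ENNReal.ofReal 2 by simp, ← ENNReal.ofReal_mul (by norm_num)]
      refine ENNReal.ofReal_le_ofReal ?_
      have h : t + t⁻¹ * (x : ℝ) ^ 2 - 2 * x = t⁻¹ * (t - x) ^ 2 := by field_simp; ring
      have : 0 ≤ t⁻¹ * (t - x) ^ 2 := by positivity
      linarith
  rw [withDensity_apply _ hA, ← lintegral_const_mul _ hL]
  calc ∫⁻ a in A, 2 * L a ∂P₀
      ≤ ∫⁻ a in A, (ENNReal.ofReal t + ENNReal.ofReal t⁻¹ * L a ^ 2) ∂P₀ :=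
        lintegral_mono fun a => key _
    _ = ENNReal.ofReal t * P₀ A + ENNReal.ofReal t⁻¹ * ∫⁻ a in A, L a ^ 2 ∂P₀ := by
        rw [lintegral_add_left measurable_const, lintegral_const_mul _ (hL.pow_const 2)]
        simp
    _ ≤ _ := by
        gcongr
        exact Measure.restrict_le_self

/-! ### Sigmoid estimates and Gaussian linear forms -/

/-- From `exp (-t) ≤ 1 / (1 + t)` one gets `2 σ(t) - 1 ≥ t / (2 + t)`. The linear growth makes the
cost of a wrong label proportional to the length of `β`. -/
theorem div_three_le_two_mul_sigmoid_sub_one {t : ℝ} (h0 : 0 ≤ t) (h1 : t ≤ 1) :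
    t / 3 ≤ 2 * Real.sigmoid t - 1 := by
  have h : Real.exp (-t) ≤ (1 + t)⁻¹ := by
    rw [Real.exp_neg]
    exact inv_anti₀ (by linarith) (by linarith [Real.add_one_le_exp t])
  have h2 : (1 + (1 + t)⁻¹)⁻¹ ≤ Real.sigmoid t := by
    rw [Real.sigmoid_def]
    exact inv_anti₀ (by positivity) (by linarith)
  have h3 : (1 + (1 + t)⁻¹)⁻¹ = (1 + t) / (2 + t) := by
    field_simp; ring
  have h4 : t / 3 ≤ 2 * ((1 + t) / (2 + t)) - 1 := by
    have : 2 * ((1 + t) / (2 + t)) - 1 = t / (2 + t) := by field_simp; ring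
    rw [this]
    exact div_le_div_of_nonneg_left h0 (by linarith) (by linarith)
  linarith

/-- The function `2 σ - 1` is odd, and on `[0, 1)` it is at most `u / (2 - u) ≤ u`. It controls the
information in one label. -/
theorem two_mul_sigmoid_sub_one_sq_le (t : ℝ) : (2 * Real.sigmoid t - 1) ^ 2 ≤ t ^ 2 := by
  have key : ∀ u : ℝ, 0 ≤ u → |2 * Real.sigmoid u - 1| ≤ u := by
    intro u hu
    have h0 : 2⁻¹ ≤ Real.sigmoid u := by
      rw [← Real.sigmoid_zero]; exact Real.sigmoid_le hu
    rw [abs_of_nonneg (by linarith)]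
    rcases le_or_gt 1 u with h1 | h1
    · linarith [Real.sigmoid_le_one u]
    · have h : 1 - u ≤ Real.exp (-u) := by linarith [Real.add_one_le_exp (-u)]
      have h2 : Real.sigmoid u ≤ (2 - u)⁻¹ := by
        rw [Real.sigmoid_def]
        exact inv_anti₀ (by linarith) (by linarith)
      have h3 : (2 - u)⁻¹ * 2 - 1 ≤ u := by
        have hpos : 0 < 2 - u := by linarith
        have : (2 - u)⁻¹ * 2 - 1 = u / (2 - u) := by field_simp; ring
        rw [this, div_le_iff₀ hpos]; nlinarith
      linarith
  rw [sq_le_sq]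
  rcases le_total 0 t with ht | ht
  · rw [abs_of_nonneg ht]; exact key t ht
  · have := key (-t) (by linarith)
    rw [Real.sigmoid_neg] at this
    rw [abs_of_nonpos ht, abs_sub_comm]
    have e : 1 - 2 * Real.sigmoid t = 2 * (1 - Real.sigmoid t) - 1 := by ring
    rwa [e]

theorem variance_inner_stdGaussian {d : ℕ} (v : EuclideanSpace ℝ (Fin d)) :
    Var[fun x => inner ℝ v x; stdGaussian (EuclideanSpace ℝ (Fin d))] = ‖v‖ ^ 2 := by
  have := variance_dual_stdGaussian (innerSL ℝ v)
  rw [innerSL_apply_norm] at this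
  exact this

theorem integral_inner_stdGaussian {d : ℕ} (v : EuclideanSpace ℝ (Fin d)) :
    ∫ x, inner ℝ v x ∂(stdGaussian (EuclideanSpace ℝ (Fin d))) = 0 :=
  integral_strongDual_stdGaussian (innerSL ℝ v)

theorem hasGaussianLaw_inner {d : ℕ} (v : EuclideanSpace ℝ (Fin d)) :
    HasGaussianLaw (fun x => inner ℝ v x) (stdGaussian (EuclideanSpace ℝ (Fin d))) :=
  IsGaussian.hasGaussianLaw_id.map_fun (innerSL ℝ v)

theorem lintegral_inner_sq {d : ℕ} (v : EuclideanSpace ℝ (Fin d)) :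
    ∫⁻ x, ENNReal.ofReal (inner ℝ v x ^ 2) ∂(stdGaussian (EuclideanSpace ℝ (Fin d))) =
      ENNReal.ofReal (‖v‖ ^ 2) := by
  have hm : MemLp (fun x => inner ℝ v x) 2 (stdGaussian (EuclideanSpace ℝ (Fin d))) :=
    (hasGaussianLaw_inner v).memLp_two
  rw [← ofReal_integral_eq_lintegral_ofReal hm.integrable_sq
    (Filter.Eventually.of_forall fun x => sq_nonneg _), ← variance_inner_stdGaussian v,
    variance_of_integral_eq_zero hm.aemeasurable (integral_inner_stdGaussian v)]

/-! ### Likelihood ratios and their second moments -/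

/-- The density of `model β` with respect to `model 0`, under which labels are fair coins. -/
def likelihoodRatio {d : ℕ} (β : EuclideanSpace ℝ (Fin d)) (z : Obs d) : ℝ≥0∞ :=
  ENNReal.ofReal (2 * labelProb β z)

theorem measurable_likelihoodRatio {d : ℕ} (β : EuclideanSpace ℝ (Fin d)) :
    Measurable (likelihoodRatio β) :=
  ((measurable_labelProb β).const_mul 2).ennreal_ofReal

theorem labelProb_zero {d : ℕ} (z : Obs d) : labelProb 0 z = 1 / 2 := by
  unfold labelProb regFun
  rw [inner_zero_left, Real.sigmoid_zero]
  split_ifs <;> norm_num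

theorem model_eq_withDensity {d : ℕ} (β : EuclideanSpace ℝ (Fin d)) :
    model β = (model 0).withDensity (likelihoodRatio β) := by
  rw [model, model, ← withDensity_mul _ (measurable_labelProb 0).ennreal_ofReal
    (measurable_likelihoodRatio β)]
  congr 1
  ext z
  rw [Pi.mul_apply, likelihoodRatio, labelProb_zero, ← ENNReal.ofReal_mul (by norm_num)]
  congr 1
  ring

theorem lintegral_model {d : ℕ} (β : EuclideanSpace ℝ (Fin d)) {g : Obs d → ℝ≥0∞}
    (hg : Measurable g) :
    ∫⁻ z, g z ∂(model β) = ∫⁻ x, (ENNReal.ofReal (regFun β x) * g (x, true) +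
      ENNReal.ofReal (1 - regFun β x) * g (x, false))
        ∂(stdGaussian (EuclideanSpace ℝ (Fin d))) := by
  have hm : Measurable fun z => ENNReal.ofReal (labelProb β z) :=
    (measurable_labelProb β).ennreal_ofReal
  rw [model, lintegral_withDensity_eq_lintegral_mul _ hm hg,
    lintegral_prod _ (hm.mul hg).aemeasurable]
  simp [lintegral_count, labelProb]

/-- Given `x`, averaging the squared ratio over a fair label yields `1 + (2 η(x) - 1) ^ 2 ≤ 1 + ⟨β,
x⟩ ^ 2`. The exponential form makes the bound multiply over samples. -/
theorem lintegral_likelihoodRatio_sq_le {d : ℕ} (β : EuclideanSpace ℝ (Fin d)) :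
    ∫⁻ z, likelihoodRatio β z ^ 2 ∂(model 0) ≤ ENNReal.ofReal (Real.exp (‖β‖ ^ 2)) := by
  rw [lintegral_model 0 ((measurable_likelihoodRatio β).pow_const 2)]
  calc _ ≤ ∫⁻ x, (1 + ENNReal.ofReal (inner ℝ β x ^ 2))
        ∂(stdGaussian (EuclideanSpace ℝ (Fin d))) := by
        refine lintegral_mono fun x => ?_
        have h0 := regFun_nonneg β x
        have h1 := regFun_le_one β x
        have h2 := two_mul_sigmoid_sub_one_sq_le (inner ℝ β x)
        have h3 : regFun (0 : EuclideanSpace ℝ (Fin d)) x = 1 / 2 := by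
          simp [regFun, Real.sigmoid_zero]
        simp only [likelihoodRatio, labelProb, h3, if_true]
        rw [if_neg (by simp), ← ENNReal.ofReal_pow (by linarith), ← ENNReal.ofReal_pow (by linarith),
          ← ENNReal.ofReal_mul (by norm_num), ← ENNReal.ofReal_mul (by norm_num),
          ← ENNReal.ofReal_add (by positivity) (by positivity), ← ENNReal.ofReal_one,
          ← ENNReal.ofReal_add (by norm_num) (by positivity)]
        refine ENNReal.ofReal_le_ofReal ?_
        change (2 * regFun β x - 1) ^ 2 ≤ _ at h2
        nlinarith
    _ = ENNReal.ofReal (1 + ‖β‖ ^ 2) := by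
        rw [lintegral_add_left measurable_const, lintegral_inner_sq,
          ENNReal.ofReal_add zero_le_one (by positivity)]
        simp
    _ ≤ _ := ENNReal.ofReal_le_ofReal (by linarith [Real.add_one_le_exp (‖β‖ ^ 2)])

instance {d nQ nP : ℕ} (β w : EuclideanSpace ℝ (Fin d)) :
    IsProbabilityMeasure (dataLaw nQ nP β w) := by
  unfold dataLaw; infer_instance

/-- The density of `dataLaw nQ nP β w` with respect to `dataLaw nQ nP 0 0`. -/
def dataRatio {d : ℕ} (nQ nP : ℕ) (β w : EuclideanSpace ℝ (Fin d)) (D : Data d nQ nP) : ℝ≥0∞ :=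
  (∏ i, likelihoodRatio β (D.1 i)) * ∏ i, likelihoodRatio w (D.2 i)

theorem measurable_prod_likelihoodRatio {d n : ℕ} (β : EuclideanSpace ℝ (Fin d)) :
    Measurable fun x : Fin n → Obs d => ∏ i, likelihoodRatio β (x i) :=
  Finset.measurable_fun_prod _ fun i _ =>
    (measurable_likelihoodRatio β).comp (measurable_pi_apply i)

theorem measurable_dataRatio {d : ℕ} (nQ nP : ℕ) (β w : EuclideanSpace ℝ (Fin d)) :
    Measurable (dataRatio nQ nP β w) :=
  ((measurable_prod_likelihoodRatio β).comp measurable_fst).mul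
    ((measurable_prod_likelihoodRatio w).comp measurable_snd)

theorem pi_model_eq_withDensity {d : ℕ} (n : ℕ) (β : EuclideanSpace ℝ (Fin d)) :
    Measure.pi (fun _ : Fin n => model β) =
      (Measure.pi fun _ : Fin n => model 0).withDensity fun x => ∏ i, likelihoodRatio β (x i) := by
  have : SigmaFinite ((model (0 : EuclideanSpace ℝ (Fin d))).withDensity (likelihoodRatio β)) := by
    rw [← model_eq_withDensity]; infer_instance
  rw [model_eq_withDensity β, pi_withDensity _ fun _ => measurable_likelihoodRatio β]

theorem dataLaw_eq_withDensity {d : ℕ} (nQ nP : ℕ) (β w : EuclideanSpace ℝ (Fin d)) :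
    dataLaw nQ nP β w = (dataLaw nQ nP 0 0).withDensity (dataRatio nQ nP β w) := by
  have : SFinite ((Measure.pi fun _ : Fin nP => model (0 : EuclideanSpace ℝ (Fin d))).withDensity
      fun x => ∏ i, likelihoodRatio w (x i)) := by
    rw [← pi_model_eq_withDensity]; infer_instance
  rw [dataLaw, pi_model_eq_withDensity nQ β, pi_model_eq_withDensity nP w,
    prod_withDensity (measurable_prod_likelihoodRatio β) (measurable_prod_likelihoodRatio w)]
  rfl

theorem lintegral_pi_likelihoodRatio_sq_le {d : ℕ} (n : ℕ) (β : EuclideanSpace ℝ (Fin d)) :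
    ∫⁻ x, (∏ i, likelihoodRatio β (x i)) ^ 2 ∂(Measure.pi fun _ : Fin n => model 0) ≤
      ENNReal.ofReal (Real.exp (n * ‖β‖ ^ 2)) := by
  simp_rw [← Finset.prod_pow]
  rw [lintegral_pi_prod (fun _ : Fin n => model 0)
    (f := fun _ z => likelihoodRatio β z ^ 2) fun _ => (measurable_likelihoodRatio β).pow_const 2]
  rw [Finset.prod_const, Finset.card_univ, Fintype.card_fin, Real.exp_nat_mul,
    ENNReal.ofReal_pow (Real.exp_pos _).le]
  exact pow_le_pow_left' (lintegral_likelihoodRatio_sq_le β) n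

theorem lintegral_dataRatio_sq_le {d : ℕ} (nQ nP : ℕ) (β w : EuclideanSpace ℝ (Fin d)) :
    ∫⁻ D, dataRatio nQ nP β w D ^ 2 ∂(dataLaw nQ nP 0 0) ≤
      ENNReal.ofReal (Real.exp (nQ * ‖β‖ ^ 2 + nP * ‖w‖ ^ 2)) := by
  simp_rw [dataRatio, mul_pow]
  rw [dataLaw, lintegral_prod_mul
    ((measurable_prod_likelihoodRatio β).pow_const 2).aemeasurable
    ((measurable_prod_likelihoodRatio w).pow_const 2).aemeasurable, Real.exp_add,
    ENNReal.ofReal_mul (Real.exp_pos _).le]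
  exact mul_le_mul' (lintegral_pi_likelihoodRatio_sq_le nQ β)
    (lintegral_pi_likelihoodRatio_sq_le nP w)

/-! ### Excess risk as an integral of pointwise losses -/

/-- The conditional probability of misclassifying the covariate `x` by the label `b`. -/
def pointRisk {d : ℕ} (β x : EuclideanSpace ℝ (Fin d)) (b : Bool) : ℝ :=
  if b = true then 1 - regFun β x else regFun β x

theorem pointRisk_nonneg {d : ℕ} (β x : EuclideanSpace ℝ (Fin d)) (b : Bool) :
    0 ≤ pointRisk β x b := by
  unfold pointRisk
  split_ifs
  · linarith [regFun_le_one β x]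
  · exact regFun_nonneg β x

theorem pointRisk_le_one {d : ℕ} (β x : EuclideanSpace ℝ (Fin d)) (b : Bool) :
    pointRisk β x b ≤ 1 := by
  unfold pointRisk
  split_ifs
  · linarith [regFun_nonneg β x]
  · exact regFun_le_one β x

theorem measurable_pointRisk {d : ℕ} (β : EuclideanSpace ℝ (Fin d))
    {f : EuclideanSpace ℝ (Fin d) → Bool} (hf : Measurable f) :
    Measurable fun x => pointRisk β x (f x) :=
  Measurable.ite (hf (measurableSet_singleton true))
    (measurable_const.sub (measurable_regFun β)) (measurable_regFun β)

theorem integrable_pointRisk {d : ℕ} (β : EuclideanSpace ℝ (Fin d))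
    {f : EuclideanSpace ℝ (Fin d) → Bool} (hf : Measurable f) :
    Integrable (fun x => pointRisk β x (f x)) (stdGaussian (EuclideanSpace ℝ (Fin d))) := by
  refine Integrable.of_bound (measurable_pointRisk β hf).aestronglyMeasurable 1
    (Filter.Eventually.of_forall fun x => ?_)
  rw [Real.norm_eq_abs, abs_of_nonneg (pointRisk_nonneg _ _ _)]
  exact pointRisk_le_one _ _ _

theorem measurableSet_misclassified {d : ℕ} {f : EuclideanSpace ℝ (Fin d) → Bool}
    (hf : Measurable f) : MeasurableSet {z : Obs d | z.2 ≠ f z.1} :=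
  (measurableSet_eq_fun measurable_snd (hf.comp measurable_fst)).compl

theorem measurable_bayesClassifier {d : ℕ} (β : EuclideanSpace ℝ (Fin d)) :
    Measurable (bayesClassifier (regFun β)) := by
  refine measurable_to_bool ?_
  have : bayesClassifier (regFun β) ⁻¹' {true} = {x | 1 / 2 ≤ regFun β x} := by
    ext x; simp [bayesClassifier]
  rw [this]
  exact measurableSet_le measurable_const (measurable_regFun β)

theorem risk_eq_integral {d : ℕ} (β : EuclideanSpace ℝ (Fin d))
    {f : EuclideanSpace ℝ (Fin d) → Bool} (hf : Measurable f) :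
    risk (model β) f =
      ∫ x, pointRisk β x (f x) ∂(stdGaussian (EuclideanSpace ℝ (Fin d))) := by
  rw [risk, measureReal_def, model_apply β (measurableSet_misclassified hf),
    integral_eq_lintegral_of_nonneg_ae
      (Filter.Eventually.of_forall fun x => pointRisk_nonneg _ _ _)
      (measurable_pointRisk β hf).aestronglyMeasurable]
  congr 1
  refine lintegral_congr fun x => ?_
  cases h : f x <;> simp [Set.indicator, h, labelProb, pointRisk]

theorem excessRisk_eq_integral {d : ℕ} (β : EuclideanSpace ℝ (Fin d))
    {f : EuclideanSpace ℝ (Fin d) → Bool} (hf : Measurable f) :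
    excessRisk β f = ∫ x, (pointRisk β x (f x) - pointRisk β x (bayesClassifier (regFun β) x))
      ∂(stdGaussian (EuclideanSpace ℝ (Fin d))) := by
  rw [excessRisk, risk_eq_integral β hf, risk_eq_integral β (measurable_bayesClassifier β),
    integral_sub (integrable_pointRisk β hf)
      (integrable_pointRisk β (measurable_bayesClassifier β))]

theorem pointRisk_bayesClassifier_le {d : ℕ} (β x : EuclideanSpace ℝ (Fin d)) (b : Bool) :
    pointRisk β x (bayesClassifier (regFun β) x) ≤ pointRisk β x b := by
  unfold pointRisk bayesClassifier
  by_cases h : 1 / 2 ≤ regFun β x <;> cases b <;> simp only [h, decide_true, decide_false] <;>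
    simp <;> linarith

/-- Predicting against the sign of `⟨β, x⟩` costs at least `t / 3` whenever `|⟨β, x⟩| ≥ t`. -/
theorem div_three_le_pointRisk_sub {d : ℕ} {β x : EuclideanSpace ℝ (Fin d)} {b : Bool} {t : ℝ}
    (h0 : 0 ≤ t) (h1 : t ≤ 1)
    (h : (b = false ∧ t ≤ inner ℝ β x) ∨ (b = true ∧ inner ℝ β x ≤ -t)) :
    t / 3 ≤ pointRisk β x b - pointRisk β x (bayesClassifier (regFun β) x) := by
  have hs := div_three_le_two_mul_sigmoid_sub_one h0 h1
  rcases h with ⟨rfl, h⟩ | ⟨rfl, h⟩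
  · have h2 : Real.sigmoid t ≤ regFun β x := Real.sigmoid_le h
    have := pointRisk_bayesClassifier_le β x true
    have e1 : pointRisk β x true = 1 - regFun β x := rfl
    have e2 : pointRisk β x false = regFun β x := rfl
    linarith
  · have h2 : regFun β x ≤ 1 - Real.sigmoid t := by
      rw [← Real.sigmoid_neg]; exact Real.sigmoid_le h
    have := pointRisk_bayesClassifier_le β x false
    have e1 : pointRisk β x true = 1 - regFun β x := rfl
    have e2 : pointRisk β x false = regFun β x := rfl
    linarith

/-! ### Separation of regression vectors -/

theorem map_inner_stdGaussian {d : ℕ} (v : EuclideanSpace ℝ (Fin d)) :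
    (stdGaussian (EuclideanSpace ℝ (Fin d))).map (fun x => inner ℝ v x) =
      (gaussianReal 0 1).map (‖v‖ * ·) := by
  rw [(hasGaussianLaw_inner v).map_eq_gaussianReal, integral_inner_stdGaussian,
    variance_inner_stdGaussian, gaussianReal_map_const_mul, mul_zero, mul_one]
  congr 1
  ext
  simp

theorem measureReal_abs_inner {d : ℕ} (v : EuclideanSpace ℝ (Fin d)) {S : Set ℝ}
    (hS : MeasurableSet S) :
    (stdGaussian (EuclideanSpace ℝ (Fin d))).real {x | inner ℝ v x ∈ S} =
      (gaussianReal 0 1).real {y | ‖v‖ * y ∈ S} := by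
  have h := congrArg (fun μ => μ.real S) (map_inner_stdGaussian v)
  rw [map_measureReal_apply (by fun_prop) hS, map_measureReal_apply (by fun_prop) hS] at h
  exact h

theorem indepFun_inner {d : ℕ} {u v : EuclideanSpace ℝ (Fin d)} (h : inner ℝ u v = 0) :
    IndepFun (fun x => inner ℝ u x) (fun x => inner ℝ v x)
      (stdGaussian (EuclideanSpace ℝ (Fin d))) := by
  refine HasGaussianLaw.indepFun_of_covariance_eq_zero ?_ ?_
  · exact IsGaussian.hasGaussianLaw_id.map_fun ((innerSL ℝ u).prod (innerSL ℝ v))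
  · rw [← covarianceBilin_apply_eq_cov IsGaussian.memLp_two_id, covarianceBilin_stdGaussian]
    exact h

/-- A lower bound for the probability that two directions at angle at least `π / 3` give opposite
and not too small inner products, divided by `12`. -/
def separationConst : ℝ :=
  (gaussianReal 0 1).real {y : ℝ | 1 ≤ |y|} * (gaussianReal 0 1).real {y : ℝ | |y| ≤ 1 / 4} / 12

theorem gaussianReal_real_pos {S : Set ℝ} {a b : ℝ} (hab : a < b) (h : Set.Ioo a b ⊆ S) :
    0 < (gaussianReal 0 1).real S := by
  refine ENNReal.toReal_pos (fun h0 => ?_) (measure_ne_top _ _)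
  have h1 := gaussianReal_absolutelyContinuous' 0 one_ne_zero (measure_mono_null h h0)
  simp only [Real.volume_Ioo, ENNReal.ofReal_eq_zero] at h1
  linarith

theorem separationConst_pos : 0 < separationConst := by
  refine div_pos (mul_pos ?_ ?_) (by norm_num)
  · exact gaussianReal_real_pos (a := 1) (b := 2) (by norm_num)
      fun y hy => hy.1.le.trans (le_abs_self y)
  · exact gaussianReal_real_pos (a := 0) (b := 1 / 4) (by norm_num)
      fun y hy => by
        change |y| ≤ 1 / 4
        rw [abs_of_pos hy.1]; exact hy.2.le

/-- Equal lengths make `β - β'` and `β + β'` orthogonal, so their inner products with `x` are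
independent centred Gaussians, with standard deviations at least `κ` and at most `2 κ`. -/
theorem separation_probability {d : ℕ} {β β' : EuclideanSpace ℝ (Fin d)} {κ : ℝ} (hκ : 0 < κ)
    (hβ : ‖β‖ = κ) (hβ' : ‖β'‖ = κ) (h : inner ℝ β β' ≤ κ ^ 2 / 2) :
    12 * separationConst ≤ (stdGaussian (EuclideanSpace ℝ (Fin d))).real
      {x | κ ≤ |inner ℝ (β - β') x| ∧ |inner ℝ (β + β') x| ≤ κ / 2} := by
  have horth : inner ℝ (β - β') (β + β') = 0 := by
    rw [inner_sub_left, inner_add_right, inner_add_right, real_inner_self_eq_norm_sq,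
      real_inner_self_eq_norm_sq, hβ, hβ', real_inner_comm β β']
    ring
  have hD : κ ≤ ‖β - β'‖ := by
    have := norm_sub_sq_real β β'
    rw [hβ, hβ'] at this
    exact le_of_sq_le_sq (by nlinarith) (norm_nonneg _)
  have hS : ‖β + β'‖ ≤ 2 * κ := by
    have := norm_add_le β β'
    rw [hβ, hβ'] at this
    linarith
  have m1 : MeasurableSet {t : ℝ | κ ≤ |t|} := measurableSet_le measurable_const (by fun_prop)
  have m2 : MeasurableSet {t : ℝ | |t| ≤ κ / 2} := measurableSet_le (by fun_prop) measurable_const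
  have hind := (indepFun_inner horth).measure_inter_preimage_eq_mul _ _ m1 m2
  have hind' : (stdGaussian (EuclideanSpace ℝ (Fin d))).real
      {x | κ ≤ |inner ℝ (β - β') x| ∧ |inner ℝ (β + β') x| ≤ κ / 2} =
      (stdGaussian (EuclideanSpace ℝ (Fin d))).real {x | inner ℝ (β - β') x ∈ {t : ℝ | κ ≤ |t|}} *
      (stdGaussian (EuclideanSpace ℝ (Fin d))).real
        {x | inner ℝ (β + β') x ∈ {t : ℝ | |t| ≤ κ / 2}} := by
    simp only [measureReal_def, ← ENNReal.toReal_mul]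
    exact congrArg ENNReal.toReal hind
  rw [hind', measureReal_abs_inner _ m1, measureReal_abs_inner _ m2, separationConst,
    mul_div_cancel₀ _ (by norm_num)]
  refine mul_le_mul (measureReal_mono fun y hy => ?_) (measureReal_mono fun y hy => ?_)
    measureReal_nonneg measureReal_nonneg
  · have hy : 1 ≤ |y| := hy
    change κ ≤ |‖β - β'‖ * y|
    rw [abs_mul, abs_norm]
    nlinarith [norm_nonneg (β - β')]
  · have hy : |y| ≤ 1 / 4 := hy
    change |‖β + β'‖ * y| ≤ κ / 2
    rw [abs_mul, abs_norm]
    nlinarith [norm_nonneg (β + β'), abs_nonneg y]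

/-- No classifier has small excess risk for two well-separated regression vectors at once. -/
theorem separation_excessRisk {d : ℕ} {β β' : EuclideanSpace ℝ (Fin d)} {κ : ℝ} (hκ : 0 < κ)
    (hκ1 : κ ≤ 1) (hβ : ‖β‖ = κ) (hβ' : ‖β'‖ = κ) (h : inner ℝ β β' ≤ κ ^ 2 / 2)
    {f : EuclideanSpace ℝ (Fin d) → Bool} (hf : Measurable f) :
    separationConst * κ ≤ excessRisk β f + excessRisk β' f := by
  set G : Set (EuclideanSpace ℝ (Fin d)) :=
    {x | κ ≤ |inner ℝ (β - β') x| ∧ |inner ℝ (β + β') x| ≤ κ / 2} with hG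
  have mG : MeasurableSet G := by
    rw [hG, Set.ofPred_and]
    refine MeasurableSet.inter ?_ ?_
    · exact measurableSet_le measurable_const (by fun_prop)
    · exact measurableSet_le (by fun_prop) measurable_const
  have hi : ∀ γ : EuclideanSpace ℝ (Fin d), Integrable (fun x => pointRisk γ x (f x) -
      pointRisk γ x (bayesClassifier (regFun γ) x)) (stdGaussian (EuclideanSpace ℝ (Fin d))) :=
    fun γ => (integrable_pointRisk γ hf).sub (integrable_pointRisk γ (measurable_bayesClassifier γ))
  rw [excessRisk_eq_integral β hf, excessRisk_eq_integral β' hf, ← integral_add (hi β) (hi β')]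
  calc separationConst * κ
      ≤ (stdGaussian (EuclideanSpace ℝ (Fin d))).real G * (κ / 4 / 3) := by
        have := separation_probability hκ hβ hβ' h
        nlinarith
    _ = ∫ x, G.indicator (fun _ => κ / 4 / 3) x ∂(stdGaussian (EuclideanSpace ℝ (Fin d))) := by
        rw [integral_indicator_const _ mG, smul_eq_mul]
    _ ≤ _ := by
        refine integral_mono ((integrable_const _).indicator mG) ((hi β).add (hi β')) fun x => ?_
        have n1 := sub_nonneg.2 (pointRisk_bayesClassifier_le β x (f x))
        have n2 := sub_nonneg.2 (pointRisk_bayesClassifier_le β' x (f x))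
        have k0 : 0 ≤ κ / 4 := by linarith
        have k1 : κ / 4 ≤ 1 := by linarith
        by_cases hx : x ∈ G
        · rw [Set.indicator_of_mem hx]
          obtain ⟨h1, h2⟩ := hx
          rw [inner_sub_left] at h1
          rw [inner_add_left, abs_le] at h2
          -- Half the sum and half the difference of the two forms show that one of `⟨β, x⟩`, `⟨β',
          -- x⟩` is at least `κ / 4` and the other at most `-κ / 4`.
          rcases le_abs.1 h1 with h1 | h1
          · cases hb : f x
            · have := div_three_le_pointRisk_sub (β := β) (x := x) (b := false) k0 k1
                (Or.inl ⟨rfl, by linarith⟩)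
              rw [hb] at n2
              linarith
            · have := div_three_le_pointRisk_sub (β := β') (x := x) (b := true) k0 k1
                (Or.inr ⟨rfl, by linarith⟩)
              rw [hb] at n1
              linarith
          · cases hb : f x
            · have := div_three_le_pointRisk_sub (β := β') (x := x) (b := false) k0 k1
                (Or.inl ⟨rfl, by linarith⟩)
              rw [hb] at n1
              linarith
            · have := div_three_le_pointRisk_sub (β := β) (x := x) (b := true) k0 k1
                (Or.inr ⟨rfl, by linarith⟩)
              rw [hb] at n2
              linarith
        · rw [Set.indicator_of_notMem hx]
          exact add_nonneg n1 n2

/-! ### From packings to minimax bounds -/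

theorem measurable_classifier {d nQ nP : ℕ}
    {f : Data d nQ nP → EuclideanSpace ℝ (Fin d) → Bool}
    (hf : f ∈ empiricalClassifiers d nQ nP) (D : Data d nQ nP) : Measurable (f D) :=
  Measurable.comp (g := fun q : Data d nQ nP × EuclideanSpace ℝ (Fin d) => f q.1 q.2) hf
    measurable_prodMk_left

theorem measurable_excessRisk {d nQ nP : ℕ}
    {f : Data d nQ nP → EuclideanSpace ℝ (Fin d) → Bool}
    (hf : f ∈ empiricalClassifiers d nQ nP) (β : EuclideanSpace ℝ (Fin d)) :
    Measurable fun D => excessRisk β (f D) := by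
  have hS : MeasurableSet {q : Data d nQ nP × Obs d | q.2.2 ≠ f q.1 q.2.1} := by
    refine (measurableSet_eq_fun (measurable_snd.comp measurable_snd) ?_).compl
    exact Measurable.comp (g := fun q : Data d nQ nP × EuclideanSpace ℝ (Fin d) => f q.1 q.2) hf
      (measurable_fst.prodMk (measurable_fst.comp measurable_snd))
  exact ((measurable_measure_prodMk_left (ν := model β) hS).ennreal_toReal).sub measurable_const

theorem two_mul_dataLaw_le {d nQ nP : ℕ} (β w : EuclideanSpace ℝ (Fin d))
    {A : Set (Data d nQ nP)} (hA : MeasurableSet A) {t Λ : ℝ} (ht : 0 < t)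
    (hΛ : Real.exp (nQ * ‖β‖ ^ 2 + nP * ‖w‖ ^ 2) ≤ Λ) :
    2 * (dataLaw nQ nP β w).real A ≤ t * (dataLaw nQ nP 0 0).real A + t⁻¹ * Λ := by
  have h := two_mul_withDensity_le (dataLaw nQ nP 0 0) (measurable_dataRatio nQ nP β w) hA ht
  rw [← dataLaw_eq_withDensity] at h
  have h2 := h.trans (add_le_add_right (mul_le_mul_right
    ((lintegral_dataRatio_sq_le nQ nP β w).trans (ENNReal.ofReal_le_ofReal hΛ)) _) _)
  have two_mul_ofReal : ∀ x : ℝ, 2 * ENNReal.ofReal x = ENNReal.ofReal (2 * x) := fun x => by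
    rw [ENNReal.ofReal_mul zero_le_two, ENNReal.ofReal_ofNat]
  have hΛ0 : 0 ≤ Λ := (Real.exp_pos _).le.trans hΛ
  rw [← ofReal_measureReal, ← ofReal_measureReal, ← ENNReal.ofReal_mul ht.le,
    ← ENNReal.ofReal_mul (inv_nonneg.2 ht.le), two_mul_ofReal _, ← ENNReal.ofReal_add (by positivity) (by positivity)] at h2
  exact (ENNReal.ofReal_le_ofReal_iff (by positivity)).1 h2

/-- If every point lies in at most `N` of the sets `A ω`, their measures add up to at most `N`. -/
theorem sum_measureReal_le {α Ω : Type*} [MeasurableSpace α] [Fintype Ω] (μ : Measure α)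
    [IsProbabilityMeasure μ] {A : Ω → Set α} (hA : ∀ ω, MeasurableSet (A ω)) {N : ℕ}
    (hN : ∀ x, ∀ T : Finset Ω, (∀ ω ∈ T, x ∈ A ω) → T.card ≤ N) :
    ∑ ω, μ.real (A ω) ≤ N := by
  classical
  have h1 : ∀ ω, μ.real (A ω) = ∫ x, (A ω).indicator (fun _ => (1 : ℝ)) x ∂μ := fun ω => by
    rw [integral_indicator_const _ (hA ω), smul_eq_mul, mul_one]
  have hint : ∀ ω, Integrable ((A ω).indicator fun _ => (1 : ℝ)) μ := fun ω =>
    (integrable_const _).indicator (hA ω)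
  simp_rw [h1]
  rw [← integral_finsetSum _ fun ω _ => hint ω]
  calc _ ≤ ∫ _, (N : ℝ) ∂μ := by
        refine integral_mono (integrable_finsetSum _ fun ω _ => hint ω) (integrable_const _)
          fun x => ?_
        have : ∑ ω, (A ω).indicator (fun _ => (1 : ℝ)) x =
            ((Finset.univ.filter fun ω => x ∈ A ω).card : ℝ) := by
          rw [Finset.card_filter]
          push_cast
          exact Finset.sum_congr rfl fun ω _ => by simp [Set.indicator]
        change ∑ ω, (A ω).indicator (fun _ => (1 : ℝ)) x ≤ N
        rw [this]
        exact_mod_cast hN x _ fun ω hω => (Finset.mem_filter.1 hω).2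
    _ = N := by simp

/-- Markov's inequality, with `p` a lower bound for the probability that the excess risk reaches
`δ`. -/
theorem le_expectedExcessRisk {d nQ nP : ℕ}
    {f : Data d nQ nP → EuclideanSpace ℝ (Fin d) → Bool}
    (hf : f ∈ empiricalClassifiers d nQ nP) (β w : EuclideanSpace ℝ (Fin d)) {δ p : ℝ}
    (hδ : 0 ≤ δ) (h : (dataLaw nQ nP β w).real {D | excessRisk β (f D) < δ} ≤ 1 - p) :
    ENNReal.ofReal (δ * p) ≤ expectedExcessRisk f β w := by
  have hm := measurable_excessRisk hf β
  have hA : MeasurableSet {D | excessRisk β (f D) < δ} := measurableSet_lt hm measurable_const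
  have hp : p ≤ (dataLaw nQ nP β w).real {D | excessRisk β (f D) < δ}ᶜ := by
    rw [probReal_compl_eq_one_sub hA]
    linarith
  calc ENNReal.ofReal (δ * p) ≤ ENNReal.ofReal δ *
        dataLaw nQ nP β w {D | excessRisk β (f D) < δ}ᶜ := by
        rw [ENNReal.ofReal_mul hδ, ← ofReal_measureReal]
        gcongr
    _ ≤ ENNReal.ofReal δ *
        dataLaw nQ nP β w {D | ENNReal.ofReal δ ≤ ENNReal.ofReal (excessRisk β (f D))} := by
        gcongr
        intro D hD
        exact ENNReal.ofReal_le_ofReal (not_lt.1 hD)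
    _ ≤ _ := mul_meas_ge_le_lintegral hm.ennreal_ofReal _

/-- Minimax lower bound from a finite family of target vectors of common length `κ`, each of which
is close to at most `N` members, when the source vectors are the target vectors scaled by `τ`. -/
theorem le_minimaxExcessRisk {d s nQ nP : ℕ} {Δ κ τ : ℝ} {Ω : Type*} [Fintype Ω] [Nonempty Ω]
    (β : Ω → EuclideanSpace ℝ (Fin d)) (hmem : ∀ ω, (β ω, τ • β ω) ∈ paramSpace d s Δ)
    (hκ : 0 < κ) (hκ1 : κ ≤ 1) (hβ : ∀ ω, ‖β ω‖ = κ) (hτ : (nP : ℝ) * τ ^ 2 ≤ nQ) {N : ℕ}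
    (hN : ∀ ω, ∀ T : Finset Ω, (∀ ω' ∈ T, κ ^ 2 / 2 < inner ℝ (β ω) (β ω')) → T.card ≤ N)
    (hbound : N * Real.exp (2 * (nQ * κ ^ 2)) ≤ 3 / 4 * Fintype.card Ω) :
    ENNReal.ofReal (separationConst * κ / 16) ≤ minimaxExcessRisk d s nQ nP Δ := by
  refine le_iInf₂ fun f hf => ?_
  set δ := separationConst * κ / 2 with hδ
  have hδ0 : 0 ≤ δ := by have := separationConst_pos; positivity
  set A : Ω → Set (Data d nQ nP) := fun ω => {D | excessRisk (β ω) (f D) < δ} with hA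
  have mA : ∀ ω, MeasurableSet (A ω) := fun ω =>
    measurableSet_lt (measurable_excessRisk hf (β ω)) measurable_const
  have hclose : ∀ D ω ω', D ∈ A ω → D ∈ A ω' → κ ^ 2 / 2 < inner ℝ (β ω) (β ω') := by
    intro D ω ω' h1 h2
    by_contra! hle
    have := separation_excessRisk hκ hκ1 (hβ ω) (hβ ω') hle (measurable_classifier hf D)
    have h1 : excessRisk (β ω) (f D) < δ := h1
    have h2 : excessRisk (β ω') (f D) < δ := h2
    linarith
  have hsum : ∑ ω, (dataLaw nQ nP 0 0).real (A ω) ≤ N := by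
    refine sum_measureReal_le _ mA fun D T hT => ?_
    rcases T.eq_empty_or_nonempty with rfl | ⟨ω, hω⟩
    · simp
    · exact hN ω T fun ω' hω' => hclose D ω ω' (hT ω hω) (hT ω' hω')
  -- Each vector is close to itself.
  have hNpos : 0 < (N : ℝ) := by
    obtain ⟨ω⟩ := ‹Nonempty Ω›
    have := hN ω {ω} fun ω' hω' => by
      rw [Finset.mem_singleton.1 hω', real_inner_self_eq_norm_sq, hβ]
      have : 0 < κ ^ 2 := by positivity
      linarith
    rw [Finset.card_singleton] at this
    exact_mod_cast this
  have hMpos : 0 < (Fintype.card Ω : ℝ) := by exact_mod_cast Fintype.card_pos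
  obtain ⟨ω, hω⟩ : ∃ ω, (dataLaw nQ nP (β ω) (τ • β ω)).real (A ω) ≤ 1 - 1 / 8 := by
    by_contra! hlt
    set M : ℝ := (Fintype.card Ω : ℝ)
    set Λ := Real.exp (2 * (nQ * κ ^ 2))
    -- With this `t`, summing over `ω` bounds `7 / 4 * M` by `(7 / 8 + 6 / 7) * M`, a contradiction.
    set t := 7 * M / (8 * N) with ht
    have ht0 : 0 < t := by positivity
    have hb : ∀ ω, 2 * (1 - 1 / 8 : ℝ) ≤ t * (dataLaw nQ nP 0 0).real (A ω) + t⁻¹ * Λ := by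
      intro ω
      refine le_trans (mul_le_mul_of_nonneg_left (hlt ω).le zero_le_two)
        (two_mul_dataLaw_le (β ω) (τ • β ω) (mA ω) ht0 (Real.exp_le_exp.2 ?_))
      rw [norm_smul, hβ, mul_pow, Real.norm_eq_abs, sq_abs]
      nlinarith [sq_nonneg κ]
    have h := Finset.sum_le_sum fun ω (_ : ω ∈ Finset.univ) => hb ω
    simp only [Finset.sum_add_distrib, ← Finset.mul_sum, Finset.sum_const, Finset.card_univ,
      nsmul_eq_mul] at h
    rw [show (Fintype.card Ω : ℝ) = M from rfl] at h
    have h1 : t * ∑ ω, (dataLaw nQ nP 0 0).real (A ω) ≤ 7 / 8 * M := by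
      calc _ ≤ t * N := by gcongr
        _ = 7 / 8 * M := by rw [ht]; field_simp
    have h2 : M * (t⁻¹ * Λ) ≤ 6 / 7 * M := by
      calc M * (t⁻¹ * Λ) = 8 / 7 * (N * Λ) := by rw [ht]; field_simp
        _ ≤ 8 / 7 * (3 / 4 * M) := by gcongr
        _ = 6 / 7 * M := by ring
    linarith
  refine le_trans ?_ (le_iSup₂_of_le (β ω, τ • β ω) (hmem ω)
    (le_expectedExcessRisk hf (β ω) (τ • β ω) hδ0 hω))
  exact ENNReal.ofReal_le_ofReal (by rw [hδ]; linarith)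

/-! ### Sparse block vectors -/

theorem smul_mem_paramSpace {d s : ℕ} {Δ τ : ℝ} (hΔ : 0 ≤ Δ) (hτ : 0 < τ)
    {β : EuclideanSpace ℝ (Fin d)} (hβ : β ≠ 0)
    (hs : (Finset.univ.filter fun i => β i ≠ 0).card ≤ s) :
    (β, τ • β) ∈ paramSpace d s Δ :=
  ⟨hβ, smul_ne_zero hτ.ne' hβ, hs, by
    rwa [InnerProductGeometry.angle_smul_right_of_pos _ _ hτ, InnerProductGeometry.angle_self hβ]⟩

theorem nat_mul_inv_sqrt_sq_le {nQ nP : ℕ} (hQ : 1 ≤ nQ) (hP : 1 ≤ nP) :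
    (nP : ℝ) * (√(nP : ℝ))⁻¹ ^ 2 ≤ nQ := by
  have : (0 : ℝ) < nP := by exact_mod_cast hP
  rw [inv_pow, Real.sq_sqrt this.le, mul_inv_cancel₀ this.ne']
  exact_mod_cast hQ

/-- The `b`-th block of `m` coordinates contributes the `ω b`-th of its basis vectors, times `a`. -/
def blockVector {d s m : ℕ} (h : s * m ≤ d) (a : ℝ) (ω : Fin s → Fin m) :
    EuclideanSpace ℝ (Fin d) :=
  ∑ b, a • EuclideanSpace.single (Fin.castLE h (finProdFinEquiv (b, ω b))) (1 : ℝ)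

/-- Distinct blocks use disjoint coordinates, so only blocks where both choices agree contribute. -/
theorem inner_blockVector {d s m : ℕ} (h : s * m ≤ d) (a : ℝ) (ω ω' : Fin s → Fin m) :
    inner ℝ (blockVector h a ω) (blockVector h a ω') =
      a ^ 2 * (Finset.univ.filter fun b => ω' b = ω b).card := by
  have key : ∀ b b', inner ℝ
      (a • EuclideanSpace.single (Fin.castLE h (finProdFinEquiv (b, ω b))) (1 : ℝ))
      (a • EuclideanSpace.single (Fin.castLE h (finProdFinEquiv (b', ω' b'))) (1 : ℝ)) =
      if b = b' then (if ω' b = ω b then a ^ 2 else 0) else 0 := by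
    intro b b'
    rw [real_inner_smul_left, real_inner_smul_right, EuclideanSpace.inner_single_left]
    by_cases hb : b = b'
    · subst hb
      by_cases hω : ω' b = ω b
      · simp [hω, sq]
      · simp [hω, Ne.symm hω]
    · simp [hb]
  simp_rw [blockVector, sum_inner, inner_sum, key]
  simp only [Finset.sum_ite_eq, Finset.mem_univ, if_true]
  rw [← Finset.sum_filter, Finset.sum_const, nsmul_eq_mul, mul_comm]

theorem norm_blockVector {d s m : ℕ} (h : s * m ≤ d) {κ : ℝ} (hκ : 0 ≤ κ) (hs : 1 ≤ s)
    (ω : Fin s → Fin m) : ‖blockVector h (κ / √s) ω‖ = κ := by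
  have hs' : (0 : ℝ) < s := by exact_mod_cast hs
  rw [norm_eq_sqrt_real_inner, inner_blockVector]
  simp only [Finset.filter_true, Finset.card_univ, Fintype.card_fin]
  rw [div_pow, Real.sq_sqrt hs'.le, div_mul_cancel₀ _ hs'.ne', Real.sqrt_sq hκ]

theorem card_support_blockVector_le {d s m : ℕ} (h : s * m ≤ d) (a : ℝ) (ω : Fin s → Fin m) :
    (Finset.univ.filter fun i => blockVector h a ω i ≠ 0).card ≤ s := by
  classical
  calc _ ≤ (Finset.univ.image fun b => Fin.castLE h (finProdFinEquiv (b, ω b))).card := by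
        refine Finset.card_le_card fun i hi => ?_
        by_contra hni
        refine (Finset.mem_filter.1 hi).2 ?_
        have : ∀ b, i ≠ Fin.castLE h (finProdFinEquiv (b, ω b)) := fun b hb =>
          hni (Finset.mem_image.2 ⟨b, Finset.mem_univ _, hb.symm⟩)
        simp only [blockVector, WithLp.ofLp_sum, Finset.sum_apply]
        refine Finset.sum_eq_zero fun b _ => ?_
        simp [this b]
    _ ≤ _ := Finset.card_image_le.trans (by simp)

/-- At most `(2 √m) ^ s` functions agree with a given one in more than half of the places. -/
theorem card_agree_le {s m : ℕ} (hm : 1 ≤ m) (ω : Fin s → Fin m) (T : Finset (Fin s → Fin m))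
    (hT : ∀ ω' ∈ T, s ≤ 2 * (Finset.univ.filter fun b => ω' b = ω b).card) :
    (T.card : ℝ) ≤ (2 * √m) ^ s := by
  have hm0 : (0 : ℝ) < m := by exact_mod_cast hm
  have hm1 : (1 : ℝ) ≤ m := by exact_mod_cast hm
  have hsq : 1 ≤ √(m : ℝ) := Real.one_le_sqrt.2 hm1
  have hprod : ∀ ω' : Fin s → Fin m, (m : ℝ) ^ (Finset.univ.filter fun b => ω' b = ω b).card =
      ∏ b, if ω' b = ω b then (m : ℝ) else 1 := fun ω' => by
    rw [Finset.prod_ite, Finset.prod_const, Finset.prod_const_one, mul_one]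
  -- An exponential moment count: weighting `ω'` by `m` to the number of agreements factorises over
  -- blocks, each contributing `2 m - 1`. Members of `T` have weight at least `√m ^ s`.
  have hsum : ∑ ω' : Fin s → Fin m, (m : ℝ) ^ (Finset.univ.filter fun b => ω' b = ω b).card ≤
      (2 * m) ^ s := by
    simp_rw [hprod]
    rw [← Fintype.piFinset_univ, ← Finset.prod_univ_sum (fun _ => Finset.univ)
      (fun b j => if j = ω b then (m : ℝ) else 1)]
    calc _ ≤ ∏ _b : Fin s, (2 * m : ℝ) := by
          refine Finset.prod_le_prod (fun b _ => Finset.sum_nonneg fun j _ => ?_) fun b _ => ?_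
          · split_ifs <;> linarith
          · calc ∑ j, (if j = ω b then (m : ℝ) else 1)
                ≤ ∑ j, ((if j = ω b then (m : ℝ) else 0) + 1) :=
                  Finset.sum_le_sum fun j _ => by split_ifs <;> linarith
              _ = 2 * m := by
                  rw [Finset.sum_add_distrib]
                  simp
                  ring
      _ = _ := by simp
  have hlow : (T.card : ℝ) * √m ^ s ≤ (2 * m) ^ s := by
    calc (T.card : ℝ) * √m ^ s = ∑ _ω' ∈ T, √m ^ s := by rw [Finset.sum_const, nsmul_eq_mul]
      _ ≤ ∑ ω' ∈ T, (m : ℝ) ^ (Finset.univ.filter fun b => ω' b = ω b).card := by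
          refine Finset.sum_le_sum fun ω' hω' => ?_
          calc √(m : ℝ) ^ s ≤ √m ^ (2 * (Finset.univ.filter fun b => ω' b = ω b).card) :=
                pow_le_pow_right₀ hsq (hT ω' hω')
            _ = _ := by rw [pow_mul, Real.sq_sqrt hm0.le]
      _ ≤ ∑ ω' : Fin s → Fin m, (m : ℝ) ^ (Finset.univ.filter fun b => ω' b = ω b).card :=
          Finset.sum_le_univ_sum_of_nonneg fun ω' => by positivity
      _ ≤ _ := hsum
  have hp : 0 < √(m : ℝ) ^ s := by positivity
  refine le_of_mul_le_mul_right (hlow.trans_eq ?_) hp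
  rw [← mul_pow, mul_assoc, Real.mul_self_sqrt hm0.le]

/-! ### Block and two-point lower bounds -/

/-- Lower bound of the order `√(s log m / nQ)` from `s` blocks of `m` coordinates. -/
theorem le_minimaxExcessRisk_block {d s m nQ nP : ℕ} {Δ : ℝ} (hs : 1 ≤ s) (hm : 16 ≤ m)
    (hd : s * m ≤ d) (hQ : 1 ≤ nQ) (hP : 1 ≤ nP) (hΔ : 0 ≤ Δ) :
    ENNReal.ofReal (separationConst * √(min 1 (s * Real.log m / (16 * nQ))) / 16) ≤
      minimaxExcessRisk d s nQ nP Δ := by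
  have hm0 : (0 : ℝ) < m := by exact_mod_cast (by omega : 0 < m)
  have hs1 : (1 : ℝ) ≤ s := by exact_mod_cast hs
  have hQ0 : (0 : ℝ) < nQ := by exact_mod_cast hQ
  have hP0 : (0 : ℝ) < nP := by exact_mod_cast hP
  have hl : 4 * Real.log 2 ≤ Real.log m := by
    have : Real.log ((2 : ℝ) ^ 4) = 4 * Real.log 2 := by rw [Real.log_pow]; norm_num
    rw [← this]
    exact Real.log_le_log (by norm_num) (by norm_num; exact_mod_cast hm)
  have hl2 := Real.log_two_gt_d9
  set ℓ := Real.log m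
  set q := min 1 (s * ℓ / (16 * nQ)) with hq
  have hℓ : 0 < ℓ := by linarith
  have hq0 : 0 < q := lt_min one_pos (by positivity)
  have hκ : 0 < √q := Real.sqrt_pos.2 hq0
  have hκ1 : √q ≤ 1 := Real.sqrt_le_one.2 (min_le_left _ _)
  have : NeZero m := ⟨by omega⟩
  have hnorm := norm_blockVector (κ := √q) hd hκ.le hs
  refine le_minimaxExcessRisk (τ := (√(nP : ℝ))⁻¹) (N := ⌊(2 * √m) ^ s⌋₊)
    (fun ω : Fin s → Fin m => blockVector hd (√q / √s) ω) (fun ω => ?_) hκ hκ1 hnorm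
    (nat_mul_inv_sqrt_sq_le hQ hP) (fun ω T hT => ?_) ?_
  · refine smul_mem_paramSpace hΔ (by positivity) ?_ (card_support_blockVector_le hd _ ω)
    rw [← norm_ne_zero_iff, hnorm]
    exact hκ.ne'
  · refine Nat.le_floor (card_agree_le (by omega) ω T fun ω' hω' => ?_)
    have h := hT ω' hω'
    rw [inner_blockVector, div_pow, Real.sq_sqrt hq0.le, Real.sq_sqrt (by linarith)] at h
    have h2 : (s : ℝ) ≤ 2 * (Finset.univ.filter fun b => ω' b = ω b).card := by
      rw [div_mul_eq_mul_div, div_lt_div_iff₀ two_pos (by linarith)] at h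
      have := lt_of_mul_lt_mul_left (h.trans_eq (by ring :
        _ = q * (2 * ((Finset.univ.filter fun b => ω' b = ω b).card : ℝ)))) hq0.le
      exact this.le
    exact_mod_cast h2
  · have hfl : (⌊(2 * √(m : ℝ)) ^ s⌋₊ : ℝ) ≤ (2 * √m) ^ s := Nat.floor_le (by positivity)
    have e2 : (2 : ℝ) ^ s = Real.exp (s * Real.log 2) := by
      rw [Real.exp_nat_mul, Real.exp_log two_pos]
    have em : √(m : ℝ) ^ s = Real.exp (s * (ℓ / 2)) := by
      rw [Real.exp_nat_mul, ← Real.log_sqrt hm0.le, Real.exp_log (Real.sqrt_pos.2 hm0)]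
    have hexp : nQ * √q ^ 2 ≤ s * ℓ / 16 := by
      rw [Real.sq_sqrt hq0.le]
      calc nQ * q ≤ nQ * (s * ℓ / (16 * nQ)) := by gcongr; exact min_le_right _ _
        _ = s * ℓ / 16 := by field_simp
    have h34 : Real.exp (-(1 / 3)) ≤ 3 / 4 := by
      rw [Real.exp_neg, inv_le_comm₀ (Real.exp_pos _) (by norm_num)]
      linarith [Real.add_one_le_exp (1 / 3 : ℝ)]
    have hsl : 4 * Real.log 2 * s ≤ s * ℓ := by nlinarith
    calc (⌊(2 * √(m : ℝ)) ^ s⌋₊ : ℝ) * Real.exp (2 * (nQ * √q ^ 2))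
        ≤ (2 * √m) ^ s * Real.exp (s * ℓ / 8) := by
          gcongr
          linarith
      _ = Real.exp (s * Real.log 2 + s * ℓ / 8) * √m ^ s := by
          rw [mul_pow, e2, Real.exp_add]; ring
      -- Here `m ≥ 16` enters: `3 / 8 * ℓ ≥ 3 / 2 * log 2`, leaving slack `log 2 / 2 > 1 / 3` beyond
      -- `log 2` in each block.
      _ ≤ Real.exp (-(1 / 3) + s * (ℓ / 2)) * √m ^ s := by
          refine mul_le_mul_of_nonneg_right (Real.exp_le_exp.2 ?_) (by positivity)
          nlinarith [mul_le_mul_of_nonneg_left hs1 (Real.log_nonneg one_le_two)]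
      _ = Real.exp (-(1 / 3)) * (√m ^ s * √m ^ s) := by rw [Real.exp_add, ← em]; ring
      _ ≤ 3 / 4 * (√m ^ s * √m ^ s) := by gcongr
      _ = 3 / 4 * (Fintype.card (Fin s → Fin m) : ℝ) := by
          rw [← mul_pow, Real.mul_self_sqrt hm0.le]
          simp

/-- Lower bound of the order `√(1 / nQ)` from two opposite target vectors. -/
theorem le_minimaxExcessRisk_two_point {d s nQ nP : ℕ} {Δ : ℝ} (hs : 1 ≤ s) (hd : 1 ≤ d)
    (hQ : 1 ≤ nQ) (hP : 1 ≤ nP) (hΔ : 0 ≤ Δ) :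
    ENNReal.ofReal (separationConst * √(1 / (8 * nQ)) / 16) ≤ minimaxExcessRisk d s nQ nP Δ := by
  have hQ1 : (1 : ℝ) ≤ nQ := by exact_mod_cast hQ
  have hP0 : (0 : ℝ) < nP := by exact_mod_cast hP
  have hq0 : (0 : ℝ) < 1 / (8 * nQ) := by positivity
  have hq1 : (1 : ℝ) / (8 * nQ) ≤ 1 := by
    rw [div_le_one (by positivity)]; linarith
  -- This makes the exponent `2 * nQ * κ ^ 2` equal to `1 / 4`, and `exp (1 / 4) ≤ 3 / 2` is the
  -- condition for two hypotheses with `N = 1`.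
  set q : ℝ := 1 / (8 * nQ) with hq
  have hκ : 0 < √q := Real.sqrt_pos.2 hq0
  set β : Bool → EuclideanSpace ℝ (Fin d) := fun b =>
    EuclideanSpace.single (⟨0, hd⟩ : Fin d) (if b = true then √q else -√q) with hβ
  have hnorm : ∀ b, ‖β b‖ = √q := by
    intro b
    cases b <;> simp [hβ]
  refine le_minimaxExcessRisk (τ := (√(nP : ℝ))⁻¹) (N := 1) β (fun b => ?_) hκ
    (Real.sqrt_le_one.2 hq1) hnorm (nat_mul_inv_sqrt_sq_le hQ hP) (fun b T hT => ?_) ?_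
  · refine smul_mem_paramSpace hΔ (by positivity) ?_ (le_trans ?_ hs)
    · rw [← norm_ne_zero_iff, hnorm]
      exact hκ.ne'
    · refine Finset.card_le_one.2 fun i hi j hj => ?_
      have : ∀ i, β b i ≠ 0 → i = ⟨0, hd⟩ := fun i hi => by
        by_contra h
        exact hi (by simp [hβ, h])
      rw [this i (Finset.mem_filter.1 hi).2, this j (Finset.mem_filter.1 hj).2]
  · have : ∀ b' ∈ T, b' = b := by
      intro b' hb'
      have h := hT b' hb'
      rw [Real.sq_sqrt hq0.le] at h
      by_contra hne
      have : inner ℝ (β b) (β b') = -q := by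
        have hqq := Real.mul_self_sqrt hq0.le
        cases b <;> cases b' <;>
          first
          | exact absurd rfl hne
          | simp [hβ, EuclideanSpace.inner_single_left, hqq]
      linarith
    exact Finset.card_le_one.2 fun x hx y hy => (this x hx).trans (this y hy).symm
  · have : (nQ : ℝ) * √q ^ 2 = 1 / 8 := by
      rw [Real.sq_sqrt hq0.le, hq]; field_simp
    rw [this]
    have h : Real.exp (2 * (1 / 8)) ≤ 3 / 2 := by
      have h1 := Real.add_one_le_exp (-(1 / 4) : ℝ)
      rw [Real.exp_neg] at h1
      have h2 : Real.exp (1 / 4) ≤ (3 / 4 : ℝ)⁻¹ := by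
        rw [le_inv_comm₀ (Real.exp_pos _) (by norm_num)]; linarith
      norm_num at h2 ⊢
      linarith
    simp only [Fintype.card_bool]
    push_cast
    linarith

/-! ### Comparison with the claimed rate -/

/-- The claimed rate is bounded by a constant, since `nQ` or `nP` exceeds `s log d / C`. -/
theorem rate_le {x nQ nP C Δ : ℝ} (hx : x / max nQ nP ≤ C) (hΔ0 : 0 ≤ Δ)
    (hΔ : Δ ≤ Real.pi / 2) : min (x / nP + Δ ^ 2) (x / nQ) ≤ C + 4 := by
  rcases le_total nQ nP with h | h
  · rw [max_eq_right h] at hx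
    have : Δ ≤ 2 := by linarith [Real.pi_le_four]
    exact (min_le_left _ _).trans (by nlinarith)
  · rw [max_eq_left h] at hx
    exact (min_le_right _ _).trans (by linarith)

theorem self_le_sqrt {q : ℝ} (h0 : 0 ≤ q) (h1 : q ≤ 1) : q ≤ √q :=
  Real.le_sqrt_of_sq_le (by nlinarith)

/-- With `m = d / s` rounded down, `e d / s ≤ 3 (m + 1) ≤ m ^ 2` once `m ≥ 16`, so `log m` can
replace `log d` up to a factor `2 K`. -/
theorem log_le_two_mul_log_div {d s : ℕ} {K : ℝ} (hK : 0 < K) (hs : 1 ≤ s) (hm : 16 ≤ d / s)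
    (h : Real.log d ≤ K * Real.log (Real.exp 1 * d / s)) :
    Real.log d ≤ 2 * K * Real.log (d / s : ℕ) := by
  have hs0 : (0 : ℝ) < s := by exact_mod_cast hs
  have hm1 : (16 : ℝ) ≤ (d / s : ℕ) := by exact_mod_cast hm
  have hd : (d : ℝ) / s ≤ (d / s : ℕ) + 1 := by
    rw [div_le_iff₀ hs0]
    have := Nat.lt_mul_div_succ d (by omega : 0 < s)
    have : (d : ℝ) < s * ((d / s : ℕ) + 1) := by exact_mod_cast this
    linarith
  have hd0 : 0 < (d : ℝ) := by
    have : 0 < d := by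
      rcases Nat.eq_zero_or_pos d with rfl | h0
      · simp at hm
      · exact h0
    exact_mod_cast this
  have he := Real.exp_one_lt_d9
  have key : Real.exp 1 * d / s ≤ ((d / s : ℕ) : ℝ) ^ 2 := by
    rw [mul_div_assoc]
    have h1 : Real.exp 1 * ((d : ℝ) / s) ≤ 3 * ((d / s : ℕ) + 1) := by
      have : 0 ≤ (d : ℝ) / s := by positivity
      nlinarith
    nlinarith
  have hlog := Real.log_le_log (by positivity) key
  rw [Real.log_pow] at hlog
  push_cast at hlog
  nlinarith

/-- Here `log (e d / s) ≤ 1 + log 16 ≤ 4`, so `log d ≤ 4 K` and `s ≤ d ≤ exp (4 K)`. -/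
theorem mul_log_le_of_div_lt {d s : ℕ} {K : ℝ} (hK : 0 < K) (hs : 1 ≤ s) (hsd : s ≤ d)
    (hm : d / s < 16) (h : Real.log d ≤ K * Real.log (Real.exp 1 * d / s)) :
    s * Real.log d ≤ 4 * K * Real.exp (4 * K) := by
  have hs0 : (0 : ℝ) < s := by exact_mod_cast hs
  have hd1 : (1 : ℝ) ≤ d := by exact_mod_cast hs.trans hsd
  have hd : (d : ℝ) / s ≤ 16 := by
    rw [div_le_iff₀ hs0]
    have := (Nat.div_lt_iff_lt_mul (by omega : 0 < s)).1 hm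
    exact_mod_cast this.le
  have hlog : Real.log (Real.exp 1 * d / s) ≤ 4 := by
    rw [mul_div_assoc, Real.log_mul (Real.exp_pos _).ne' (by positivity), Real.log_exp]
    have h1 : Real.log ((d : ℝ) / s) ≤ Real.log ((2 : ℝ) ^ 4) :=
      Real.log_le_log (by positivity) (by linarith)
    rw [Real.log_pow] at h1
    push_cast at h1
    linarith [Real.log_two_lt_d9]
  have hld : Real.log d ≤ 4 * K := by nlinarith
  have hse : (s : ℝ) ≤ Real.exp (4 * K) := by
    calc (s : ℝ) ≤ d := by exact_mod_cast hsd
      _ = Real.exp (Real.log d) := (Real.exp_log (by linarith)).symm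
      _ ≤ _ := Real.exp_le_exp.2 hld
  calc s * Real.log d ≤ Real.exp (4 * K) * (4 * K) :=
        mul_le_mul hse hld (Real.log_nonneg hd1) (Real.exp_pos _).le
    _ = _ := by ring

end LogisticTransfer

end

theorem mainTheorem7 (C K : ℝ) (hC : 0 < C) (hK : 0 < K) :
    ∃ c : ℝ, 0 < c ∧
      ∀ (d s nQ nP : ℕ) (Δ : ℝ), 1 ≤ s → s ≤ d → 1 ≤ nQ → 1 ≤ nP →
        0 ≤ Δ → Δ ≤ Real.pi / 2 →
        Real.log (d : ℝ) ≤ K * Real.log (Real.exp 1 * (d : ℝ) / (s : ℝ)) →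
        (s : ℝ) * Real.log (d : ℝ) / max (nQ : ℝ) (nP : ℝ) ≤ C →
        ENNReal.ofReal (c * min ((s : ℝ) * Real.log (d : ℝ) / (nP : ℝ) + Δ ^ 2)
            ((s : ℝ) * Real.log (d : ℝ) / (nQ : ℝ))) ≤
          LogisticTransfer.minimaxExcessRisk d s nQ nP Δ := by
  have hp := LogisticTransfer.separationConst_pos
  set p := LogisticTransfer.separationConst
  -- `C + 4` serves the case where the length is capped at one, `32 * K` the uncapped block bound,
  -- and the last term the two-point bound.
  set B := C + 4 + 32 * K + 32 * K * Real.exp (4 * K) with hB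
  have hKe : 0 < 32 * K * Real.exp (4 * K) := by positivity
  have hB0 : 0 < B := by positivity
  refine ⟨p / 16 / B, by positivity, ?_⟩
  intro d s nQ nP Δ hs hsd hQ hP hΔ0 hΔ hK' hmax
  have hQ1 : (1 : ℝ) ≤ nQ := by exact_mod_cast hQ
  have hs0 : (0 : ℝ) < s := by exact_mod_cast hs
  have hT := LogisticTransfer.rate_le hmax hΔ0 hΔ
  have hTQ := min_le_right ((s : ℝ) * Real.log d / nP + Δ ^ 2) ((s : ℝ) * Real.log d / nQ)
  set T := min ((s : ℝ) * Real.log d / nP + Δ ^ 2) ((s : ℝ) * Real.log d / nQ)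
  have reduce : ∀ κ : ℝ, T ≤ B * κ → ENNReal.ofReal (p * κ / 16) ≤
      LogisticTransfer.minimaxExcessRisk d s nQ nP Δ → ENNReal.ofReal (p / 16 / B * T) ≤
      LogisticTransfer.minimaxExcessRisk d s nQ nP Δ := by
    intro κ h1 h2
    refine le_trans (ENNReal.ofReal_le_ofReal ?_) h2
    calc p / 16 / B * T ≤ p / 16 / B * (B * κ) := by gcongr
      _ = p * κ / 16 := by field_simp
  rcases le_or_gt 16 (d / s) with hm | hm
  · refine reduce _ ?_ (LogisticTransfer.le_minimaxExcessRisk_block hs hm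
      (Nat.mul_div_le d s) hQ hP hΔ0)
    have hℓ : 0 ≤ Real.log ((d / s : ℕ) : ℝ) := Real.log_natCast_nonneg _
    have hld := LogisticTransfer.log_le_two_mul_log_div hK hs hm hK'
    set y := (s : ℝ) * Real.log ((d / s : ℕ) : ℝ) / (16 * nQ) with hy
    have hy0 : 0 ≤ y := by positivity
    have hTy : T ≤ 32 * K * y := by
      refine hTQ.trans ?_
      calc (s : ℝ) * Real.log d / nQ ≤ s * (2 * K * Real.log ((d / s : ℕ) : ℝ)) / nQ := by gcongr
        _ = 32 * K * y := by rw [hy]; field_simp; ring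
    have hsq := LogisticTransfer.self_le_sqrt (le_min zero_le_one hy0) (min_le_left 1 y)
    calc T ≤ B * min 1 y := by
          rcases min_choice 1 y with h | h <;> rw [h] <;> nlinarith
      _ ≤ B * √(min 1 y) := by gcongr
  · refine reduce _ ?_ (LogisticTransfer.le_minimaxExcessRisk_two_point hs (hs.trans hsd) hQ hP hΔ0)
    have hq1 : (1 : ℝ) / (8 * nQ) ≤ 1 := by
      rw [div_le_one (by positivity)]; linarith
    calc T ≤ 4 * K * Real.exp (4 * K) / nQ := by
          refine hTQ.trans ?_
          exact div_le_div_of_nonneg_right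
            (LogisticTransfer.mul_log_le_of_div_lt hK hs hsd hm hK') (by linarith)
      _ = 32 * K * Real.exp (4 * K) * (1 / (8 * nQ)) := by field_simp; ring
      _ ≤ B * √(1 / (8 * nQ)) := by
          gcongr
          · rw [hB]; linarith
          · exact LogisticTransfer.self_le_sqrt (by positivity) hq1
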